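/- For $n\ge 0$ let $\mathfrak S_n$ be the set of permutations of $\{1,\dots,n\}$. For $\pi\in\mathfrak S_n$ let $\mathrm{fp}(\pi)=|\{i:\pi_i=i\}|$ be its number of fixed points and $\mathrm{exc}(\pi)=|\{i:\pi_i>i\}|$ its number of excedances. A permutation $\pi$ avoids a pattern $\sigma\in\mathfrak S_m$ if it has no subsequence of length $m$ in the same relative order as $\sigma$; for a set $\Sigma$ of patterns, $\mathfrak S_n(\Sigma)$ is the set of $\pi\in\mathfrak S_n$ avoiding every pattern in $\Sigma$. Define the generating function $$F_\Sigma(x,q,z)=\sum_{n\ge0}\ \sum_{\pi\in\mathfrak S_n(\Sigma)}x^{\mathrm{fp}(\pi)}q^{\mathrm{exc}(\pi)}z^n\in\mathbb Z[x,q][[z]].$$ For $i,h\ge0$ let $\mathbf C_i^{\le h}$ be the number of Dyck paths of length $2i$ (lattice paths from $(0,0)$ to $(2i,0)$ with steps $(1,1)$ and $(1,-1)$ never going below the $x$-axis) whose height (largest $y$-coordinate) is at most $h$, and let $\mathbf C_{<i}^{\le h}(z)=\sum_{j=0}^{i-1}\mathbf C_j^{\le h}z^j$. **Theorem.** For every $k\ge0$,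 $$F_{\{312,\,(k+1)k\cdots 1\}}(x,q,z)=A_0^k(x,q,z),$$ where, for $0\le i\le k$, the formal power series $A_i^k(x,q,z)\in\mathbb Z[x,q][[z]]$ is defined recursively by $A_k^k(x,q,z)=1$ and, for $i<k$, $$A_i^k(x,q,z)=\frac{1}{1-z\left[(x-1)\,\mathbf C_i^{\le k-i-1}q^iz^i+(q-1)\,\mathbf C_{<i}^{\le k-i-1}(qz)+A_{i+1}^k(x,q,z)\right]}.$$ -/

import Mathlib

namespace PatternFPExc

open PowerSeries

/-! ### Pattern avoidance and the generating function of fixed points and excedances -/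

/-- A pattern: a permutation of `{0, …, m-1}` for some `m`. -/
abbrev Pattern : Type := (m : ℕ) × Equiv.Perm (Fin m)

/-- `π` contains `σ`: there are positions `f 0 < f 1 < ⋯ < f (m-1)` such that the corresponding
subsequence of `π` is in the same relative order as `σ`. -/
def Contains {n : ℕ} (π : Equiv.Perm (Fin n)) (σ : Pattern) : Prop :=
  ∃ f : Fin σ.1 ↪o Fin n, ∀ a b : Fin σ.1, π (f a) < π (f b) ↔ σ.2 a < σ.2 b

/-- `π` avoids all the patterns in `S`. -/
def Avoids {n : ℕ} (π : Equiv.Perm (Fin n)) (S : Set Pattern) : Prop :=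
  ∀ σ ∈ S, ¬ Contains π σ

/-- The number of fixed points of `π`. -/
def fp {n : ℕ} (π : Equiv.Perm (Fin n)) : ℕ :=
  (Finset.univ.filter fun i => π i = i).card

/-- The number of excedances of `π`. -/
def exc {n : ℕ} (π : Equiv.Perm (Fin n)) : ℕ :=
  (Finset.univ.filter fun i => i < π i).card

/-- The polynomial ring `ℤ[x, q]`. Generating functions live in `ℤ[x, q]⟦z⟧`. -/
abbrev Coeffs : Type := MvPolynomial (Fin 2) ℤ

/-- The variable `x`, marking fixed points. -/
noncomputable def x : Coeffs := MvPolynomial.X 0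

/-- The variable `q`, marking excedances. -/
noncomputable def q : Coeffs := MvPolynomial.X 1

/-- The variable `z`, marking length. -/
noncomputable def z : Coeffs⟦X⟧ := PowerSeries.X

open Classical in
/-- `F_S(x, q, z) = ∑_{n ≥ 0} ∑_{π ∈ 𝔖_n(S)} x^{fp π} q^{exc π} z^n`. -/
noncomputable def F (S : Set Pattern) : Coeffs⟦X⟧ :=
  PowerSeries.mk fun n =>
    ∑ π : Equiv.Perm (Fin n) with Avoids π S, x ^ fp π * q ^ exc π

/-- The pattern `312`, written with the values `0, 1, 2`. -/
def pattern312 : Pattern :=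
  ⟨3, { toFun := ![2, 0, 1]
        invFun := ![1, 2, 0]
        left_inv := by decide
        right_inv := by decide }⟩

/-- The decreasing pattern `m (m-1) ⋯ 2 1` of length `m`. -/
def decreasing (m : ℕ) : Pattern := ⟨m, Fin.revPerm⟩

/-! ### Dyck paths of bounded height -/

/-- The height of a Dyck path: the largest `y`-coordinate of one of its points. -/
def height (p : DyckWord) : ℕ :=
  (Finset.range (p.toList.length + 1)).sup fun i =>
    (p.toList.take i).count DyckStep.U - (p.toList.take i).count DyckStep.D

/-- `C_i^{≤ h}`: the number of Dyck paths of length `2 i` and height at most `h`. -/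
noncomputable def boundedDyck (i h : ℕ) : ℕ :=
  Nat.card {p : DyckWord // p.semilength = i ∧ height p ≤ h}

/-- The set counted by `boundedDyck` is finite, so that the cardinality is the true one. -/
theorem finite_boundedDyck (i h : ℕ) :
    Finite {p : DyckWord // p.semilength = i ∧ height p ≤ h} :=
  Finite.of_injective
    (fun p => (⟨p.1, p.2.1⟩ : {p : DyckWord // p.semilength = i}))
    (fun _ _ hab => Subtype.ext (congrArg (fun r => r.1) hab))

/-- `C_{<i}^{≤ h}(t) = ∑_{j < i} C_j^{≤ h} t^j`. -/
noncomputable def truncDyck (i h : ℕ) (t : Coeffs⟦X⟧) : Coeffs⟦X⟧ :=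
  ∑ j ∈ Finset.range i, (boundedDyck j h : Coeffs⟦X⟧) * t ^ j

/-! ### The finite continued fraction -/

/-- `1 / (1 - z B)`: the inverse of `1 - z B` in `ℤ[x, q]⟦z⟧`, which exists because the constant
term of `1 - z B` is `1`. -/
noncomputable def oneDivOneSubZMul (B : Coeffs⟦X⟧) : Coeffs⟦X⟧ :=
  PowerSeries.invOfUnit (1 - z * B) 1

theorem oneSubZMul_mul_oneDiv (B : Coeffs⟦X⟧) :
    (1 - z * B) * oneDivOneSubZMul B = 1 :=
  PowerSeries.mul_invOfUnit _ _ (by simp [z])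

/-- The series `A_i^k` for `0 ≤ i ≤ k` (it also takes the value `1`, never used, for `i > k`). -/
noncomputable def A (k i : ℕ) : Coeffs⟦X⟧ :=
  if i < k then
    oneDivOneSubZMul
      ((C x - 1) * (boundedDyck i (k - i - 1) : Coeffs⟦X⟧) * C q ^ i * z ^ i
        + (C q - 1) * truncDyck i (k - i - 1) (C q * z)
        + A k (i + 1))
  else 1
termination_by k - i

end PatternFPExc

/-!
A nonempty permutation avoiding `312` has only smaller values before its minimum than after it, so
it is uniquely of the form `(σ ⊖ 1) ⊕ τ` with `σ` and `τ` avoiding `312`; appending a minimum adds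
one to the length of the longest decreasing subsequence. Since `⊕` keeps fixed points and
excedances while `⊖ 1` raises the values of `σ` by one, the statistics are followed through the
induction with all values raised by a shift `i`: the enumerators satisfy
`Wᵢ = 1 / (1 - z Bᵢ)`, where `Bᵢ` is `Wᵢ₊₁` with the coefficient of `zᵃ` multiplied by the weight
`q` (`a < i`), `x` (`a = i`) or `1` (`a > i`) of the value `0` in position `a`.

Exactly the coefficients with `a ≤ i` have to be corrected. In these sizes the shift `i + 1` makes
every entry an excedance, and the same decomposition, read as the first-return decomposition of
Dyck paths, shows that the coefficient is `q ^ a` times the number of Dyck paths of bounded height.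
-/

namespace PatternFPExc

open PowerSeries
open Finset.HasAntidiagonal (antidiagonal mem_antidiagonal)

/-! ### First-return decomposition of Dyck paths of bounded height -/

theorem height_le_iff {p : DyckWord} {h : ℕ} :
    height p ≤ h ↔
      ∀ i, (p.toList.take i).count DyckStep.U ≤ (p.toList.take i).count DyckStep.D + h := by
  rw [height, Finset.sup_le_iff]
  refine ⟨fun H i => ?_, fun H i _ => by have := H i; omega⟩
  have := H (min i p.toList.length) (by simp)
  rwa [← List.take_eq_take_min, tsub_le_iff_left] at this

@[simp]
theorem height_zero : height 0 = 0 := by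
  simp [height, show (0 : DyckWord).toList = [] from rfl]

theorem height_add (p r : DyckWord) : height (p + r) = max (height p) (height r) := by
  refine eq_of_forall_ge_iff fun h => ?_
  have hp := p.count_U_eq_count_D
  simp only [max_le_iff, height_le_iff, show (p + r).toList = p.toList ++ r.toList from rfl,
    List.take_append, List.count_append]
  refine ⟨fun H => ⟨fun i => ?_, fun i => ?_⟩, fun ⟨Hp, Hr⟩ i => ?_⟩
  · rcases le_total i p.toList.length with hi | hi
    · simpa [Nat.sub_eq_zero_of_le hi] using H i
    · rw [List.take_of_length_le hi]
      omega
  · have := H (p.toList.length + i)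
    rw [List.take_of_length_le (Nat.le_add_right _ _), Nat.add_sub_cancel_left] at this
    omega
  · rcases le_total i p.toList.length with hi | hi
    · simpa [Nat.sub_eq_zero_of_le hi] using Hp i
    · rw [List.take_of_length_le hi]
      have := Hr (i - p.toList.length)
      omega

theorem toList_nest (p : DyckWord) :
    p.nest.toList = DyckStep.U :: (p.toList ++ [DyckStep.D]) := rfl

theorem height_nest (p : DyckWord) : height p.nest = height p + 1 := by
  have hp := p.count_U_eq_count_D
  apply le_antisymm
  · refine height_le_iff.2 fun i => ?_
    rcases i with _ | i
    · simp
    · have hi := height_le_iff.1 (le_refl (height p)) i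
      have hD : ([DyckStep.D].take (i - p.toList.length)).count DyckStep.U = 0 :=
        List.count_eq_zero.2 fun h => by simpa using List.mem_of_mem_take h
      simp only [toList_nest, List.take_succ_cons, List.take_append, List.count_cons,
        List.count_append, hD, beq_self_eq_true, if_true]
      omega
  · obtain ⟨h, hh⟩ : ∃ h, height p.nest = h + 1 := by
      refine Nat.exists_eq_succ_of_ne_zero fun h0 => ?_
      simpa [toList_nest] using height_le_iff.1 h0.le 1
    rw [hh, Nat.succ_le_succ_iff, height_le_iff]
    intro i
    rcases le_total i p.toList.length with hi | hi
    · have := height_le_iff.1 hh.le (i + 1)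
      simp only [toList_nest, List.take_succ_cons, List.take_append, Nat.sub_eq_zero_of_le hi,
        List.take_zero, List.append_nil, List.count_cons_self, ne_eq, reduceCtorEq,
        not_false_eq_true, List.count_cons_of_ne] at this
      omega
    · rw [List.take_of_length_le hi]
      omega

/-- The Dyck paths counted by `boundedDyck`, as a `Finset`, in order to count them by explicit
bijections. -/
noncomputable def boundedDyckWords (i h : ℕ) : Finset DyckWord :=
  have : Finite {p : DyckWord | p.semilength = i ∧ height p ≤ h} := finite_boundedDyck i h
  (Set.toFinite {p : DyckWord | p.semilength = i ∧ height p ≤ h}).toFinset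

@[simp]
theorem mem_boundedDyckWords {i h : ℕ} {p : DyckWord} :
    p ∈ boundedDyckWords i h ↔ p.semilength = i ∧ height p ≤ h := by
  rw [boundedDyckWords, Set.Finite.mem_toFinset, Set.mem_ofPred_eq]

theorem card_boundedDyckWords (i h : ℕ) : (boundedDyckWords i h).card = boundedDyck i h :=
  (Nat.subtype_card _ fun _ => mem_boundedDyckWords).symm

theorem semilength_eq_zero_iff {p : DyckWord} : p.semilength = 0 ↔ p = 0 := by
  refine ⟨fun hp => by_contra fun h0 => ?_, fun hp => hp ▸ DyckWord.semilength_zero⟩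
  have := DyckWord.semilength_insidePart_add_semilength_outsidePart_add_one h0
  omega

theorem boundedDyck_zero (h : ℕ) : boundedDyck 0 h = 1 := by
  rw [← card_boundedDyckWords, Finset.card_eq_one]
  refine ⟨0, Finset.ext fun p => ?_⟩
  rw [mem_boundedDyckWords, semilength_eq_zero_iff, Finset.mem_singleton]
  exact ⟨And.left, fun hp => ⟨hp, by simp [hp]⟩⟩

theorem height_eq_max_insidePart_outsidePart {p : DyckWord} (hp : p ≠ 0) :
    height p = max (height p.insidePart + 1) (height p.outsidePart) := by
  rw [← height_nest, ← height_add, DyckWord.nest_insidePart_add_outsidePart hp]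

theorem boundedDyck_succ_zero (n : ℕ) : boundedDyck (n + 1) 0 = 0 := by
  rw [← card_boundedDyckWords, Finset.card_eq_zero, Finset.eq_empty_iff_forall_notMem]
  rintro p hp
  rw [mem_boundedDyckWords] at hp
  have h0 : p ≠ 0 := by
    rintro rfl
    simp at hp
  have := height_eq_max_insidePart_outsidePart h0
  omega

theorem boundedDyck_succ_succ (n h : ℕ) :
    boundedDyck (n + 1) (h + 1) =
      ∑ ab ∈ antidiagonal n, boundedDyck ab.1 h * boundedDyck ab.2 (h + 1) := by
  simp only [← card_boundedDyckWords, ← Finset.card_product]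
  rw [← Finset.card_sigma]
  refine Finset.card_nbij'
    (fun p => ⟨(p.insidePart.semilength, p.outsidePart.semilength), p.insidePart, p.outsidePart⟩)
    (fun s => s.2.1.nest + s.2.2) ?_ ?_ ?_ ?_
  · intro p hp
    have h0 : p ≠ 0 := by
      rintro rfl
      simp at hp
    have hs := DyckWord.semilength_insidePart_add_semilength_outsidePart_add_one h0
    have hh := height_eq_max_insidePart_outsidePart h0
    simp only [SetLike.mem_coe, mem_boundedDyckWords, Finset.coe_sigma, Finset.coe_product,
      Set.mem_sigma_iff, mem_antidiagonal, Set.mem_prod, true_and] at hp ⊢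
    omega
  · rintro ⟨⟨a, b⟩, p, r⟩ hs
    simp only [Finset.coe_sigma, Finset.coe_product, Set.mem_sigma_iff, SetLike.mem_coe,
      mem_antidiagonal, Set.mem_prod, mem_boundedDyckWords, DyckWord.semilength_add,
      DyckWord.semilength_nest, height_add, height_nest, sup_le_iff] at hs ⊢
    omega
  · intro p hp
    refine DyckWord.nest_insidePart_add_outsidePart ?_
    rintro rfl
    simp at hp
  · rintro ⟨⟨a, b⟩, p, r⟩ hs
    simp only [Finset.coe_sigma, Finset.coe_product, Set.mem_sigma_iff, SetLike.mem_coe,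
      mem_antidiagonal, Set.mem_prod, mem_boundedDyckWords] at hs
    obtain ⟨-, ⟨rfl, -⟩, rfl, -⟩ := hs
    simp

/-! ### Direct sums and appended minima -/

/-- The direct sum `σ ⊕ τ`: the word of `σ` followed by the word of `τ` with its values raised
by `a`. -/
def directSum {a b : ℕ} (σ : Equiv.Perm (Fin a)) (τ : Equiv.Perm (Fin b)) :
    Equiv.Perm (Fin (a + b)) :=
  finSumFinEquiv.permCongr (Equiv.Perm.sumCongr σ τ)

/-- The skew sum `σ ⊖ 1`: the word of `σ` with its values raised by `1`, followed by the value
`0`. -/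
def appendMin {n : ℕ} (σ : Equiv.Perm (Fin n)) : Equiv.Perm (Fin (n + 1)) :=
  finSuccEquivLast.trans (σ.optionCongr.trans (finSuccEquiv n).symm)

section Structure

variable {a b n : ℕ}

@[simp]
theorem directSum_castAdd (σ : Equiv.Perm (Fin a)) (τ : Equiv.Perm (Fin b)) (i : Fin a) :
    directSum σ τ (Fin.castAdd b i) = Fin.castAdd b (σ i) := by
  simp [directSum, Equiv.permCongr_apply]

@[simp]
theorem directSum_natAdd (σ : Equiv.Perm (Fin a)) (τ : Equiv.Perm (Fin b)) (i : Fin b) :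
    directSum σ τ (Fin.natAdd a i) = Fin.natAdd a (τ i) := by
  simp [directSum, Equiv.permCongr_apply]

@[simp]
theorem appendMin_castSucc (σ : Equiv.Perm (Fin n)) (i : Fin n) :
    appendMin σ i.castSucc = (σ i).succ := by
  simp [appendMin]

@[simp]
theorem appendMin_last (σ : Equiv.Perm (Fin n)) : appendMin σ (Fin.last n) = 0 := by
  simp [appendMin]

theorem directSum_injective {σ σ' : Equiv.Perm (Fin a)} {τ τ' : Equiv.Perm (Fin b)}
    (h : directSum σ τ = directSum σ' τ') : σ = σ' ∧ τ = τ' :=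
  Prod.mk.inj <| Equiv.Perm.sumCongrHom_injective <| finSumFinEquiv.permCongr.injective h

theorem appendMin_injective : Function.Injective (appendMin (n := n)) := by
  intro σ σ' h
  ext i
  simpa using congrArg (fun π => (π i.castSucc : ℕ)) h

theorem exists_directSum_eq {π : Equiv.Perm (Fin (a + b))}
    (hπ : ∀ i : Fin a, (π (Fin.castAdd b i) : ℕ) < a) : ∃ σ τ, directSum σ τ = π := by
  have hmaps : Set.MapsTo (finSumFinEquiv.symm.permCongr π)
      (Set.range Sum.inl) (Set.range Sum.inl) := by
    rintro _ ⟨i, rfl⟩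
    refine ⟨⟨_, hπ i⟩, ?_⟩
    rw [Equiv.permCongr_apply, Equiv.eq_symm_apply]
    simp
  obtain ⟨⟨σ, τ⟩, hστ⟩ := Equiv.Perm.mem_sumCongrHom_range_of_perm_mapsTo_inl hmaps
  refine ⟨σ, τ, ?_⟩
  exact (Equiv.eq_symm_apply finSumFinEquiv.permCongr).1 hστ

theorem exists_appendMin_eq {π : Equiv.Perm (Fin (n + 1))} (hπ : π (Fin.last n) = 0) :
    ∃ σ, appendMin σ = π := by
  set π' : Equiv.Perm (Option (Fin n)) :=
    finSuccEquivLast.symm.trans (π.trans (finSuccEquiv n)) with hπ'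
  have hnone : π' none = none := by simp [hπ', hπ]
  refine ⟨Equiv.removeNone π', ?_⟩
  rw [appendMin, map_equiv_removeNone, hnone, Equiv.swap_self]
  ext i
  simp [hπ', Equiv.Perm.mul_def]

end Structure

/-! ### Pattern containment -/

section Containment

variable {a b m n : ℕ} {ρ : Pattern}

theorem contains_of_length_eq_zero (π : Equiv.Perm (Fin n)) (hρ : ρ.1 = 0) : Contains π ρ := by
  have : IsEmpty (Fin ρ.1) := hρ ▸ Fin.isEmpty'
  exact ⟨OrderEmbedding.ofIsEmpty, isEmptyElim⟩

theorem Contains.length_le {π : Equiv.Perm (Fin n)} (h : Contains π ρ) : ρ.1 ≤ n := by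
  obtain ⟨f, -⟩ := h
  simpa using Fintype.card_le_of_embedding f.toEmbedding

theorem contains_iff_exists_range {π : Equiv.Perm (Fin a)} {π' : Equiv.Perm (Fin n)}
    (e : Fin a ↪o Fin n) (he : ∀ i j, π' (e i) < π' (e j) ↔ π i < π j) :
    Contains π ρ ↔ ∃ f : Fin ρ.1 ↪o Fin n, (∀ s, ∃ i, e i = f s) ∧
      ∀ s t, π' (f s) < π' (f t) ↔ ρ.2 s < ρ.2 t := by
  constructor
  · rintro ⟨f, hf⟩
    exact ⟨f.trans e, fun s => ⟨f s, rfl⟩, fun s t => (he _ _).trans (hf s t)⟩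
  · rintro ⟨f, hrange, hf⟩
    choose g hg using hrange
    have hmono : StrictMono g := fun s t hst => by
      rw [← e.lt_iff_lt, hg, hg]
      exact f.strictMono hst
    refine ⟨OrderEmbedding.ofStrictMono g hmono, fun s t => ?_⟩
    rw [← hf, ← hg, ← hg, he]
    rfl

theorem contains_pattern312_of_lt {π : Equiv.Perm (Fin n)} {i j k : Fin n} (hij : i < j)
    (hjk : j < k) (hπjk : π j < π k) (hπki : π k < π i) : Contains π pattern312 := by
  have hmono : StrictMono ![i, j, k] := by
    simp [Fin.strictMono_iff_lt_succ, Fin.forall_fin_two, hij, hjk]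
  have horder : ∀ s t : Fin 3, π (![i, j, k] s) < π (![i, j, k] t) ↔
      (![2, 0, 1] : Fin 3 → Fin 3) s < ![2, 0, 1] t := by
    have hπji := hπjk.trans hπki
    intro s t
    fin_cases s <;> fin_cases t <;> simp [hπjk, hπki, hπji, hπjk.le, hπki.le, hπji.le]
  exact ⟨OrderEmbedding.ofStrictMono _ hmono, horder⟩

/-- A pattern is sum-indecomposable when it is not of the form `σ ⊕ τ` with `σ` and `τ` nonempty.
Here `S` is the set of positions of `σ`. -/
def SumIndecomposable (ρ : Pattern) : Prop :=
  ∀ S : Set (Fin ρ.1), IsLowerSet S → (∀ s ∈ S, ∀ t ∉ S, ρ.2 s < ρ.2 t) → S = ∅ ∨ S = Set.univ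

theorem sumIndecomposable_of_last_le_zero {ρ : Equiv.Perm (Fin (m + 1))}
    (hρ : ρ (Fin.last m) ≤ ρ 0) : SumIndecomposable ⟨m + 1, ρ⟩ := by
  intro S hS hlt
  by_contra! hne
  obtain ⟨⟨s, hs⟩, hS'⟩ := hne
  obtain ⟨t, ht⟩ := (Set.ne_univ_iff_exists_notMem S).1 hS'
  have h0 : 0 ∈ S := hS (Fin.zero_le s) hs
  have hlast : Fin.last m ∉ S := fun h => ht (hS (Fin.le_last t) h)
  exact (hlt _ h0 _ hlast).not_ge hρ

theorem sumIndecomposable_pattern312 : SumIndecomposable pattern312 :=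
  sumIndecomposable_of_last_le_zero (by decide)

theorem sumIndecomposable_decreasing_succ (m : ℕ) : SumIndecomposable (decreasing (m + 1)) :=
  sumIndecomposable_of_last_le_zero (by simp)

theorem contains_directSum_iff (σ : Equiv.Perm (Fin a)) (τ : Equiv.Perm (Fin b))
    (hρ : SumIndecomposable ρ) :
    Contains (directSum σ τ) ρ ↔ Contains σ ρ ∨ Contains τ ρ := by
  rw [contains_iff_exists_range (π := σ) (π' := directSum σ τ) (Fin.castAddOrderEmb b)
      (by simp [(Fin.strictMono_castAdd b).lt_iff_lt]),
    contains_iff_exists_range (π := τ) (π' := directSum σ τ) (Fin.natAddOrderEmb a) (by simp)]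
  refine ⟨fun ⟨f, hf⟩ => ?_, ?_⟩
  · let S : Set (Fin ρ.1) := {s | (f s : ℕ) < a}
    have hlower : IsLowerSet S := fun s t hts hs =>
      (Fin.le_def.1 (f.monotone hts)).trans_lt hs
    have hleft : ∀ s ∈ S, ∃ i, Fin.castAddOrderEmb b i = f s := fun s hs => ⟨⟨f s, hs⟩, rfl⟩
    have hright : ∀ s ∉ S, ∃ i, Fin.natAddOrderEmb a i = f s := fun s hs =>
      ⟨Fin.subNat a ((f s).cast (Nat.add_comm a b)) (not_lt.1 hs), by simp⟩
    have hcut : ∀ s ∈ S, ∀ t ∉ S, ρ.2 s < ρ.2 t := by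
      intro s hs t ht
      obtain ⟨i, hi⟩ := hleft s hs
      obtain ⟨j, hj⟩ := hright t ht
      rw [← hf, ← hi, ← hj, Fin.lt_def]
      simp only [Fin.castAddOrderEmb_apply, directSum_castAdd, Fin.val_castAdd,
        Fin.natAddOrderEmb_apply, directSum_natAdd, Fin.val_natAdd]
      omega
    rcases hρ S hlower hcut with hS | hS
    · exact Or.inr ⟨f, fun s => hright s (by simp [hS]), hf⟩
    · exact Or.inl ⟨f, fun s => hleft s (by simp [hS]), hf⟩
  · rintro (⟨f, -, hf⟩ | ⟨f, -, hf⟩) <;> exact ⟨f, hf⟩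

theorem contains_appendMin_iff_of_lt_last (σ : Equiv.Perm (Fin n)) {ρ : Equiv.Perm (Fin (m + 1))}
    {s : Fin (m + 1)} (hs : ρ s < ρ (Fin.last m)) :
    Contains (appendMin σ) ⟨m + 1, ρ⟩ ↔ Contains σ ⟨m + 1, ρ⟩ := by
  rw [contains_iff_exists_range (π := σ) (π' := appendMin σ) Fin.castSuccOrderEmb (by simp)]
  refine ⟨fun ⟨f, hf⟩ => ⟨f, fun t => Fin.exists_castSucc_eq.2 fun ht => ?_, hf⟩,
    fun ⟨f, _, hf⟩ => ⟨f, hf⟩⟩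
  have hlast : f (Fin.last m) = Fin.last n :=
    Fin.last_le_iff.1 (ht ▸ f.monotone (Fin.le_last t))
  have := (hf s (Fin.last m)).2 hs
  simp [hlast] at this

theorem contains_appendMin_appendMin_iff (σ : Equiv.Perm (Fin n)) (ρ : Equiv.Perm (Fin m)) :
    Contains (appendMin σ) ⟨m + 1, appendMin ρ⟩ ↔ Contains σ ⟨m, ρ⟩ := by
  constructor
  · rintro ⟨f, hf⟩
    rw [contains_iff_exists_range (π := σ) (π' := appendMin σ) Fin.castSuccOrderEmb (by simp)]
    refine ⟨Fin.castSuccOrderEmb.trans f, fun s => Fin.exists_castSucc_eq.2 ?_, fun s t => ?_⟩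
    · exact ((f.strictMono (Fin.castSucc_lt_last s)).trans_le (Fin.le_last _)).ne
    · simpa using hf s.castSucc t.castSucc
  · rintro ⟨f, hf⟩
    let g : Fin (m + 1) → Fin (n + 1) := Fin.lastCases (Fin.last n) fun s => (f s).castSucc
    have hmono : StrictMono g := by
      intro s t hst
      induction s using Fin.lastCases with
      | last => exact absurd (Fin.le_last t) hst.not_ge
      | cast s => induction t using Fin.lastCases <;> simp_all [g]
    refine ⟨OrderEmbedding.ofStrictMono g hmono, fun s t => ?_⟩
    induction s using Fin.lastCases <;> induction t using Fin.lastCases <;> simp_all [g]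

end Containment

/-! ### The decomposition of permutations avoiding `312` and a decreasing pattern -/

/-- The patterns `312` and `m (m-1) ⋯ 1`. -/
abbrev forbidden (m : ℕ) : Set Pattern := {pattern312, decreasing m}

theorem avoids_forbidden_iff {n : ℕ} {π : Equiv.Perm (Fin n)} {m : ℕ} :
    Avoids π (forbidden m) ↔ ¬ Contains π pattern312 ∧ ¬ Contains π (decreasing m) := by
  simp [Avoids]

theorem not_avoids_forbidden_zero {n : ℕ} (π : Equiv.Perm (Fin n)) : ¬ Avoids π (forbidden 0) :=
  fun h => (avoids_forbidden_iff.1 h).2 (contains_of_length_eq_zero π rfl)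

theorem avoids_forbidden_succ_of_isEmpty (π : Equiv.Perm (Fin 0)) (m : ℕ) :
    Avoids π (forbidden (m + 1)) :=
  avoids_forbidden_iff.2
    ⟨fun h => absurd h.length_le (by decide), fun h => absurd h.length_le (by simp [decreasing])⟩

theorem decreasing_succ (m : ℕ) : decreasing (m + 1) = ⟨m + 1, appendMin Fin.revPerm⟩ := by
  refine congrArg (Sigma.mk (m + 1)) (Equiv.ext fun i => ?_)
  induction i using Fin.lastCases <;> simp [Fin.rev_castSucc]

theorem avoids_directSum_appendMin_iff {a b : ℕ} {σ : Equiv.Perm (Fin a)}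
    {τ : Equiv.Perm (Fin b)} (m : ℕ) :
    Avoids (directSum (appendMin σ) τ) (forbidden (m + 1)) ↔
      Avoids σ (forbidden m) ∧ Avoids τ (forbidden (m + 1)) := by
  have h312 : Contains (appendMin σ) pattern312 ↔ Contains σ pattern312 :=
    contains_appendMin_iff_of_lt_last (m := 2) σ (s := 1) (by decide)
  have hdec : Contains (appendMin σ) (decreasing (m + 1)) ↔ Contains σ (decreasing m) := by
    rw [decreasing_succ, contains_appendMin_appendMin_iff, decreasing]
  rw [avoids_forbidden_iff, contains_directSum_iff _ _ sumIndecomposable_pattern312,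
    contains_directSum_iff _ _ (sumIndecomposable_decreasing_succ m), h312, hdec,
    avoids_forbidden_iff, avoids_forbidden_iff]
  tauto

theorem apply_lt_apply_of_le_of_argmin_lt {n : ℕ} {π : Equiv.Perm (Fin n)}
    (hπ : ¬ Contains π pattern312) {i p j : Fin n} (hp : ∀ k, π p ≤ π k) (hi : i ≤ p)
    (hj : p < j) : π i < π j := by
  have hpj : π p < π j := (hp j).lt_of_ne (π.injective.ne hj.ne)
  rcases hi.eq_or_lt with rfl | hi
  · exact hpj
  · by_contra! h
    have hji : π j < π i := h.lt_of_ne (π.injective.ne (hi.trans hj).ne')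
    exact hπ (contains_pattern312_of_lt hi hj hpj hji)

theorem exists_directSum_appendMin_eq {a b : ℕ} {π : Equiv.Perm (Fin (a + 1 + b))}
    (hπ : ¬ Contains π pattern312) (hmin : (π (Fin.castAdd b (Fin.last a)) : ℕ) = 0) :
    ∃ σ τ, directSum (appendMin σ) τ = π := by
  set p := Fin.castAdd b (Fin.last a) with hp
  have hpval : (p : ℕ) = a := by simp [hp]
  have hleft (i : Fin (a + 1)) : (π (Fin.castAdd b i) : ℕ) < a + 1 := by
    have hmaps : Set.MapsTo π (Finset.Ioi p) (Finset.Ioi (π (Fin.castAdd b i))) := fun j hj => by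
      rw [Finset.coe_Ioi, Set.mem_Ioi] at hj ⊢
      exact apply_lt_apply_of_le_of_argmin_lt hπ (fun k => by rw [Fin.le_def]; omega)
        (Fin.le_def.2 (by simp only [Fin.val_castAdd]; omega)) hj
    have := Finset.card_le_card_of_injOn π hmaps π.injective.injOn
    rw [Fin.card_Ioi, Fin.card_Ioi] at this
    omega
  obtain ⟨π₁, τ, rfl⟩ := exists_directSum_eq hleft
  obtain ⟨σ, rfl⟩ : ∃ σ, appendMin σ = π₁ :=
    exists_appendMin_eq (Fin.ext (by simpa [hp] using hmin))
  exact ⟨σ, τ, rfl⟩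

/-! ### Enumeration with raised values -/

/-- The contribution to `x ^ fp * q ^ exc` of the value `v` in position `p`. -/
noncomputable def entryWeight (v p : ℕ) : Coeffs :=
  if v = p then x else if p < v then q else 1

/-- The monomial `x ^ fp * q ^ exc` of the word obtained from `π` by raising all its values
by `i`. -/
noncomputable def weight (i : ℕ) {n : ℕ} (π : Equiv.Perm (Fin n)) : Coeffs :=
  ∏ p, entryWeight (π p + i) p

theorem weight_zero {n : ℕ} (π : Equiv.Perm (Fin n)) : weight 0 π = x ^ fp π * q ^ exc π := by
  rw [weight, fp, exc, ← Finset.prod_const, ← Finset.prod_const, Finset.prod_filter,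
    Finset.prod_filter, ← Finset.prod_mul_distrib]
  refine Finset.prod_congr rfl fun p _ => ?_
  simp only [entryWeight, add_zero, Fin.ext_iff, Fin.lt_def]
  split_ifs <;> first | simp | omega

theorem entryWeight_add_left (c v p : ℕ) : entryWeight (c + v) (c + p) = entryWeight v p := by
  simp [entryWeight]

theorem weight_directSum (i : ℕ) {a b : ℕ} (σ : Equiv.Perm (Fin a)) (τ : Equiv.Perm (Fin b)) :
    weight i (directSum σ τ) = weight i σ * weight i τ := by
  simp [weight, Fin.prod_univ_add, add_assoc, entryWeight_add_left]

theorem weight_appendMin (i : ℕ) {n : ℕ} (σ : Equiv.Perm (Fin n)) :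
    weight i (appendMin σ) = weight (i + 1) σ * entryWeight i n := by
  simp [weight, Fin.prod_univ_castSucc, add_assoc, add_comm 1 i]

open Classical in
/-- The coefficient of `z ^ n` in `shiftedF i S`. -/
noncomputable def weightSum (i : ℕ) (S : Set Pattern) (n : ℕ) : Coeffs :=
  ∑ π : Equiv.Perm (Fin n) with Avoids π S, weight i π

/-- The generating function `F S` with all the values of the permutations raised by `i`. -/
noncomputable def shiftedF (i : ℕ) (S : Set Pattern) : Coeffs⟦X⟧ :=
  PowerSeries.mk (weightSum i S)

theorem shiftedF_zero (S : Set Pattern) : shiftedF 0 S = F S := by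
  ext1 n
  simp only [shiftedF, F, coeff_mk, weightSum, weight_zero]

theorem weightSum_forbidden_zero (i n : ℕ) : weightSum i (forbidden 0) n = 0 := by
  simp [weightSum, not_avoids_forbidden_zero]

theorem weightSum_size_zero (i m : ℕ) : weightSum i (forbidden (m + 1)) 0 = 1 := by
  simp [weightSum, avoids_forbidden_succ_of_isEmpty, weight]

open Classical in
theorem sum_weight_of_min_position (i m : ℕ) {a b n : ℕ} (hn : a + 1 + b = n) :
    ∑ π : Equiv.Perm (Fin n) with
        Avoids π (forbidden (m + 1)) ∧ (π ⟨a, by omega⟩ : ℕ) = 0, weight i π =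
      weightSum (i + 1) (forbidden m) a * entryWeight i a * weightSum i (forbidden (m + 1)) b := by
  subst hn
  rw [weightSum, weightSum, Finset.sum_mul, Finset.sum_mul_sum, ← Finset.sum_product']
  symm
  refine Finset.sum_bij (fun s _ => directSum (appendMin s.1) s.2) ?_ ?_ ?_ ?_
  · rintro ⟨σ, τ⟩ h
    have hmin : directSum (appendMin σ) τ (Fin.castAdd b (Fin.last a)) = Fin.castAdd b 0 := by simp
    simp only [Finset.mem_product, Finset.mem_filter, Finset.mem_univ, true_and] at h ⊢
    exact ⟨(avoids_directSum_appendMin_iff m).2 h, congrArg Fin.val hmin⟩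
  · rintro ⟨σ, τ⟩ _ ⟨σ', τ'⟩ _ h
    obtain ⟨hσ, rfl⟩ := directSum_injective h
    exact Prod.ext (appendMin_injective hσ) rfl
  · intro π h
    simp only [Finset.mem_filter, Finset.mem_univ, true_and] at h
    obtain ⟨σ, τ, rfl⟩ := exists_directSum_appendMin_eq (avoids_forbidden_iff.1 h.1).1 h.2
    refine ⟨(σ, τ), ?_, rfl⟩
    simpa using (avoids_directSum_appendMin_iff m).1 h.1
  · rintro ⟨σ, τ⟩ _
    rw [weight_directSum, weight_appendMin]

theorem weightSum_succ (i m n : ℕ) :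
    weightSum i (forbidden (m + 1)) (n + 1) = ∑ ab ∈ antidiagonal n,
      weightSum (i + 1) (forbidden m) ab.1 * entryWeight i ab.1 *
        weightSum i (forbidden (m + 1)) ab.2 := by
  classical
  rw [weightSum, ← Finset.sum_fiberwise_of_maps_to (t := antidiagonal n)
    (g := fun π : Equiv.Perm (Fin (n + 1)) => ((π.symm 0 : ℕ), n - (π.symm 0 : ℕ)))
    (fun π _ => by rw [mem_antidiagonal]; simp only; omega)]
  refine Finset.sum_congr rfl ?_
  rintro ⟨a, b⟩ hab
  rw [mem_antidiagonal] at hab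
  rw [← sum_weight_of_min_position i m (show a + 1 + b = n + 1 by omega), Finset.filter_filter]
  refine Finset.sum_congr (Finset.filter_congr fun π _ => and_congr_right fun _ => ?_)
    fun _ _ => rfl
  have hposition : (π ⟨a, by omega⟩ : ℕ) = 0 ↔ (π.symm 0 : ℕ) = a := by
    rw [Fin.val_eq_zero_iff, ← Equiv.eq_symm_apply, Fin.ext_iff, eq_comm]
  rw [hposition, Prod.mk.injEq]
  omega

theorem weightSum_eq_boundedDyck_mul_pow (h : ℕ) {i n : ℕ} (hi : n ≤ i) :
    weightSum i (forbidden (h + 1)) n = boundedDyck n h * q ^ n := by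
  induction n using Nat.strong_induction_on generalizing h i with
  | _ n ih =>
    rcases n with _ | n
    · simp [weightSum_size_zero, boundedDyck_zero]
    rw [weightSum_succ]
    rcases h with _ | h
    · simp [weightSum_forbidden_zero, boundedDyck_succ_zero]
    rw [boundedDyck_succ_succ, Nat.cast_sum, Finset.sum_mul]
    refine Finset.sum_congr rfl ?_
    rintro ⟨a, b⟩ hab
    rw [mem_antidiagonal] at hab
    simp only at hab ⊢
    have hentry : entryWeight i a = q := by
      rw [entryWeight, if_neg (by omega), if_pos (by omega)]
    rw [ih a (by omega) h (by omega), ih b (by omega) (h + 1) (by omega), hentry, ← hab]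
    push_cast
    ring

/-! ### The continued fraction -/

theorem eq_oneDivOneSubZMul {B G : Coeffs⟦X⟧} (h : (1 - z * B) * G = 1) :
    G = oneDivOneSubZMul B :=
  left_inv_eq_right_inv ((mul_comm _ _).trans h) (oneSubZMul_mul_oneDiv B)

theorem shiftedF_eq_oneDivOneSubZMul (i m : ℕ) :
    shiftedF i (forbidden (m + 1)) = oneDivOneSubZMul
      (PowerSeries.mk fun a => weightSum (i + 1) (forbidden m) a * entryWeight i a) := by
  apply eq_oneDivOneSubZMul
  rw [sub_mul, one_mul, sub_eq_iff_eq_add, mul_assoc, z, shiftedF]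
  ext1 n
  rcases n with _ | n
  · simp [weightSum_size_zero]
  · rw [map_add, coeff_succ_X_mul, coeff_mk, coeff_mul, weightSum_succ]
    simp [coeff_one]

theorem shiftedF_forbidden_one (i : ℕ) : shiftedF i (forbidden 1) = 1 := by
  rw [shiftedF]
  ext1 n
  rcases n with _ | n
  · simp [weightSum_size_zero]
  · simp [weightSum_succ, weightSum_forbidden_zero, coeff_one]

theorem coeff_truncDyck (i h n : ℕ) :
    coeff n (truncDyck i h (C q * z)) = if n < i then boundedDyck n h * q ^ n else 0 := by
  have hterm (j : ℕ) : (boundedDyck j h : Coeffs⟦X⟧) * (C q * z) ^ j =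
      C ((boundedDyck j h : Coeffs) * q ^ j) * X ^ j := by
    rw [z, map_mul, map_natCast, map_pow, mul_pow, mul_assoc]
  simp only [truncDyck, hterm, map_sum, coeff_C_mul_X_pow, Finset.sum_ite_eq, Finset.mem_range]

theorem bracket_eq_mk (i h : ℕ) :
    (C x - 1) * (boundedDyck i h : Coeffs⟦X⟧) * C q ^ i * z ^ i
        + (C q - 1) * truncDyck i h (C q * z) + shiftedF (i + 1) (forbidden (h + 1)) =
      PowerSeries.mk fun a => weightSum (i + 1) (forbidden (h + 1)) a * entryWeight i a := by
  have hx : (C x - 1) * (boundedDyck i h : Coeffs⟦X⟧) * C q ^ i * z ^ i =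
      C ((x - 1) * boundedDyck i h * q ^ i) * X ^ i := by
    simp only [z, map_mul, map_sub, map_natCast, map_pow, map_one]
  have hq : (C q - 1 : Coeffs⟦X⟧) = C (q - 1) := by rw [map_sub, map_one]
  ext1 n
  rw [hx, hq, shiftedF, map_add, map_add, coeff_C_mul_X_pow, coeff_C_mul, coeff_truncDyck,
    coeff_mk, coeff_mk, entryWeight]
  rcases lt_trichotomy n i with hn | rfl | hn
  · rw [if_neg hn.ne, if_pos hn, if_neg hn.ne', if_pos hn,
      weightSum_eq_boundedDyck_mul_pow h (by omega)]
    ring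
  · rw [if_pos rfl, if_neg (lt_irrefl _), if_pos rfl,
      weightSum_eq_boundedDyck_mul_pow h (by omega)]
    ring
  · rw [if_neg hn.ne', if_neg hn.not_gt, if_neg hn.ne, if_neg hn.not_gt]
    ring

theorem shiftedF_eq_A (i h : ℕ) : shiftedF i (forbidden (h + 1)) = A (i + h) i := by
  induction h generalizing i with
  | zero => rw [shiftedF_forbidden_one, A, if_neg (by omega)]
  | succ h ih =>
    rw [A, if_pos (by omega), show i + (h + 1) - i - 1 = h by omega,
      show i + (h + 1) = i + 1 + h by omega, ← ih, bracket_eq_mk, shiftedF_eq_oneDivOneSubZMul]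

end PatternFPExc

theorem mainTheorem6 (k : ℕ) :
    PatternFPExc.F {PatternFPExc.pattern312, PatternFPExc.decreasing (k + 1)} =
      PatternFPExc.A k 0 := by
  rw [← PatternFPExc.shiftedF_zero, PatternFPExc.shiftedF_eq_A, Nat.zero_add]
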